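/- Let $p\neq\ell$ be primes, let $\overline{\mathbb Q}_\ell$ be an algebraic closure of the field $\mathbb Q_\ell$ of $\ell$-adic numbers, and for $n\geq 1$ let $\mu_n\subset\overline{\mathbb Q}_\ell^\times$ be the group of $n$-th roots of unity. Let $\Gamma$ be a finite $p$-group of exponent $p^r$, let $\rho:\Gamma\to GL(V)$ be an irreducible (finite dimensional) representation of $\Gamma$ over $\overline{\mathbb Q}_\ell$, and let $\mathrm{Aut}_\rho(\Gamma)\subset\mathrm{Aut}(\Gamma)$ be the stabilizer of the isomorphism class of $\rho$. By Schur's lemma, for each $\sigma\in\mathrm{Aut}_\rho(\Gamma)$ there is $\varphi\in GL(V)$, unique up to a scalar, with $\varphi\,\rho(\gamma)\,\varphi^{-1}=\rho(\sigma(\gamma))$ for all $\gamma\in\Gamma$. This gives a projective representation of $\mathrm{Aut}_\rho(\Gamma)$ on $V$, and the pairs $(\sigma,\varphi)$ form a central extension of $\mathrm{Aut}_\rho(\Gamma)$ by $\overline{\mathbb Q}_\ell^\times$. Let $\alpha_\rho\in H^2(\mathrm{Aut}_\rho(\Gamma),\overline{\mathbb Q}_\ell^\times)$ be its cohomology class (trivial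 action on the coefficients). Then $\alpha_\rho$ belongs to the image of the natural map $$H^2\bigl(\mathrm{Aut}_\rho(\Gamma),\mu_{p^r}\bigr)\longrightarrow H^2\bigl(\mathrm{Aut}_\rho(\Gamma),\overline{\mathbb Q}_\ell^\times\bigr)$$ induced by the inclusion $\mu_{p^r}\subset\overline{\mathbb Q}_\ell^\times$. -/

import Mathlib

open CategoryTheory

/-! ### The class in `H²` of a central extension -/

namespace CentralExtension

variable {N E G : Type*} [CommGroup N] [Group E] [Group G]

/-- An extension `1 → N → E → G → 1` is central if the image of `N` lies in the center of `E`. -/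
def IsCentral (S : GroupExtension N E G) : Prop :=
  S.inl.range ≤ Subgroup.center E

/-- The factor set of a set-theoretic section `s`: the function `f : G × G → N` determined by
`s g * s h = f (g, h) * s (g * h)` in `E`. -/
noncomputable def factorSet (S : GroupExtension N E G) (s : S.Section) (x : G × G) : N :=
  (s.mul_mul_mul_inv_mem_range_inl x.1 x.2).choose

theorem inl_factorSet_mul (S : GroupExtension N E G) (s : S.Section) (g h : G) :
    S.inl (factorSet S s (g, h)) * s (g * h) = s g * s h := by
  have := (s.mul_mul_mul_inv_mem_range_inl g h).choose_spec
  rw [factorSet, this]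
  group

theorem IsCentral.comm {S : GroupExtension N E G} (hS : IsCentral S) (n : N) (e : E) :
    e * S.inl n = S.inl n * e :=
  Subgroup.mem_center_iff.1 (hS ⟨n, rfl⟩) e

/-- The factor set of a central extension satisfies the 2-cocycle identity. -/
theorem factorSet_cocycle {S : GroupExtension N E G} (hS : IsCentral S) (s : S.Section)
    (g h j : G) :
    factorSet S s (g * h, j) * factorSet S s (g, h) =
      factorSet S s (h, j) * factorSet S s (g, h * j) := by
  apply S.inl_injective
  apply mul_right_cancel (b := s (g * h * j))
  have h1 : S.inl (factorSet S s (g * h, j) * factorSet S s (g, h)) * s (g * h * j)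
      = s g * s h * s j := by
    rw [mul_comm, map_mul, mul_assoc, inl_factorSet_mul, ← mul_assoc, inl_factorSet_mul]
  have h2 : S.inl (factorSet S s (h, j) * factorSet S s (g, h * j)) * s (g * h * j)
      = s g * s h * s j := by
    rw [map_mul, mul_assoc, mul_assoc g h j, inl_factorSet_mul, ← mul_assoc, ← hS.comm,
      mul_assoc, inl_factorSet_mul, mul_assoc]
  rw [h1, h2]

end CentralExtension

namespace CentralExtension

variable {N G : Type} {E : Type*} [CommGroup N] [Group E] [Group G]

/-- The coefficient module `N` with trivial action of `G` (written additively), so that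
`groupCohomology.H2 (trivialCoeff G N)` is `H²(G, N)`. -/
abbrev trivialCoeff (G N : Type) [Group G] [CommGroup N] : Rep ℤ G :=
  Rep.trivial ℤ G (Additive N)

/-- The morphism of trivial coefficient modules induced by a homomorphism `N → N'`. -/
def trivialCoeffMap (G : Type) [Group G] {N N' : Type} [CommGroup N] [CommGroup N']
    (φ : N →* N') : trivialCoeff G N ⟶ trivialCoeff G N' :=
  Rep.ofHom ⟨(MonoidHom.toAdditive φ).toIntLinearMap, fun _ => rfl⟩

/-- The natural map `Hⁿ(G, N) → Hⁿ(G, N')` induced by a homomorphism `N → N'`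
of trivial coefficient groups. -/
noncomputable def cohomologyMap (G : Type) [Group G] {N N' : Type} [CommGroup N] [CommGroup N']
    (φ : N →* N') (n : ℕ) :
    groupCohomology (trivialCoeff G N) n →ₗ[ℤ] groupCohomology (trivialCoeff G N') n :=
  (groupCohomology.map (MonoidHom.id G) (trivialCoeffMap G φ) n).hom

/-- The 2-cocycle on `G` with values in `N` attached to a section of a central extension. -/
noncomputable def sectionCocycle {S : GroupExtension N E G} (hS : IsCentral S) (s : S.Section) :
    groupCohomology.cocycles₂ (trivialCoeff G N) :=
  ⟨fun x => (Additive.ofMul (factorSet S s x) : Additive N), by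
    rw [groupCohomology.mem_cocycles₂_iff]
    intro g h j
    exact congrArg Additive.ofMul (factorSet_cocycle hS s g h j)⟩

/-- The class in `H²(G, N)` of the 2-cocycle attached to a section of a central extension. -/
noncomputable def sectionClass {S : GroupExtension N E G} (hS : IsCentral S) (s : S.Section) :
    groupCohomology.H2 (trivialCoeff G N) :=
  groupCohomology.H2π (trivialCoeff G N) (sectionCocycle hS s)

/-- The class does not depend on the section. -/
theorem sectionClass_eq {S : GroupExtension N E G} (hS : IsCentral S) (s t : S.Section) :
    sectionClass hS s = sectionClass hS t := by
  rw [sectionClass, sectionClass, groupCohomology.H2π_eq_iff]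
  choose c hc using s.exists_eq_inl_mul t
  refine ⟨fun g => (Additive.ofMul (c g) : Additive N), ?_⟩
  funext x
  obtain ⟨g, h⟩ := x
  have key : c h / c (g * h) * c g = factorSet S s (g, h) / factorSet S t (g, h) := by
    rw [eq_div_iff_mul_eq', ← mul_div_right_comm, mul_comm, ← mul_div_assoc, div_eq_iff_eq_mul]
    apply S.inl_injective
    apply mul_right_cancel (b := t (g * h))
    have h1 := inl_factorSet_mul S s g h
    have h2 := inl_factorSet_mul S t g h
    rw [hc g, hc h, hc (g * h)] at h1
    have h3 : S.inl (c g) * t g * (S.inl (c h) * t h)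
        = S.inl (c g) * S.inl (c h) * (t g * t h) := by
      rw [mul_assoc, ← mul_assoc (t g), hS.comm]
      simp only [mul_assoc]
    rw [h3, ← h2, ← mul_assoc, ← mul_assoc, ← map_mul, ← map_mul, ← map_mul] at h1
    rw [h1]
    congr 2
    simp only [mul_comm, mul_left_comm]
  exact congrArg (Additive.ofMul : N → Additive N) key

/-- The class in `H²(G, N)` of a central extension `1 → N → E → G → 1`. -/
noncomputable def extensionClass {S : GroupExtension N E G} (hS : IsCentral S) :
    groupCohomology.H2 (trivialCoeff G N) :=
  sectionClass hS S.surjInvRightHom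

end CentralExtension

/-! ### The central extension attached to an irreducible representation -/

namespace Representation

section

variable {K Γ V : Type*} [Field K] [Group Γ] [AddCommGroup V] [Module K V]

/-- The pullback `γ ↦ ρ (σ γ)` of a representation along an automorphism `σ`. -/
def twist (ρ : Representation K Γ V) (σ : MulAut Γ) : Representation K Γ V :=
  MonoidHom.comp ρ σ.toMonoidHom

/-- `Aut_ρ(Γ)`: the stabilizer in `Aut(Γ)` of the isomorphism class of `ρ`. -/
def autStabilizer (ρ : Representation K Γ V) : Subgroup (MulAut Γ) where
  carrier := {σ | Nonempty (ρ.Equiv (ρ.twist σ))}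
  one_mem' := ⟨Equiv.refl ρ⟩
  mul_mem' := by
    rintro σ τ ⟨f⟩ ⟨g⟩
    refine ⟨Equiv.mk (g.toLinearEquiv.trans f.toLinearEquiv) fun γ => ?_⟩
    ext v
    have h1 := IntertwiningMap.isIntertwining _ _ g.toIntertwiningMap γ v
    have h2 := IntertwiningMap.isIntertwining _ _ f.toIntertwiningMap (τ γ) (g.toIntertwiningMap v)
    exact (congrArg f.toIntertwiningMap h1).trans h2
  inv_mem' := by
    rintro σ ⟨f⟩
    refine ⟨Equiv.mk f.toLinearEquiv.symm fun γ => ?_⟩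
    ext v
    have h1 := IntertwiningMap.isIntertwining _ _ f.toIntertwiningMap (σ⁻¹ γ) (f.toLinearEquiv.symm v)
    have h2 : ρ.twist σ (σ⁻¹ γ) = ρ γ := congrArg ρ (MulAut.apply_inv_self Γ σ γ)
    have h3 : f.toIntertwiningMap (f.toLinearEquiv.symm v) = v :=
      f.toLinearEquiv.apply_symm_apply v
    rw [h2, h3] at h1
    exact f.toLinearEquiv.symm_apply_eq.2 h1.symm

/-- The group of pairs `(σ, φ)` with `σ ∈ Aut_ρ(Γ)` and `φ ∈ GL(V)` such that
`φ ∘ ρ(γ) = ρ(σ γ) ∘ φ` for all `γ`. For irreducible `ρ`, the class of `φ` in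
`GL(V)/K^×` is determined by `σ`; this is the projective representation of `Aut_ρ(Γ)`, and the
group of pairs is the pullback along it of `1 → K^× → GL(V) → GL(V)/K^× → 1`. -/
def autLift (ρ : Representation K Γ V) : Subgroup (ρ.autStabilizer × (V ≃ₗ[K] V)) where
  carrier := {x | ∀ γ v, x.2 (ρ γ v) = ρ (x.1.1 γ) (x.2 v)}
  one_mem' := fun _ _ => rfl
  mul_mem' := by
    rintro x y hx hy γ v
    exact (congrArg x.2 (hy γ v)).trans (hx (y.1.1 γ) (y.2 v))
  inv_mem' := by
    rintro x hx γ v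
    have h := hx ((x.1.1 : MulAut Γ)⁻¹ γ) (x.2.symm v)
    rw [MulAut.apply_inv_self, x.2.apply_symm_apply] at h
    exact x.2.symm_apply_eq.2 h.symm

/-- The inclusion of the scalars `K^×` as the pairs `(1, a • id)`. -/
def scalarLift (ρ : Representation K Γ V) : Kˣ →* ρ.autLift where
  toFun a := ⟨(1, LinearEquiv.smulOfUnit a), fun γ v => ((ρ γ).map_smul (a : K) v).symm⟩
  map_one' := by
    apply Subtype.ext
    refine Prod.ext rfl ?_
    ext v
    exact one_smul K v
  map_mul' a b := by
    apply Subtype.ext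
    refine Prod.ext (one_mul _).symm ?_
    ext v
    exact mul_smul (a : K) (b : K) v

/-- The projection `(σ, φ) ↦ σ` onto `Aut_ρ(Γ)`. -/
def autLiftProj (ρ : Representation K Γ V) : ρ.autLift →* ρ.autStabilizer :=
  (MonoidHom.fst _ _).comp ρ.autLift.subtype

/-- The extension `1 → K^× → autLift ρ → Aut_ρ(Γ) → 1` attached to an irreducible
representation `ρ`. -/
def autExtension [IsAlgClosed K] [FiniteDimensional K V] (ρ : Representation K Γ V)
    [hρ : ρ.IsIrreducible] : GroupExtension Kˣ ρ.autLift ρ.autStabilizer where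
  inl := ρ.scalarLift
  rightHom := ρ.autLiftProj
  inl_injective := by
    intro a b h
    have : Nontrivial V := by
      by_contra hV
      rw [not_nontrivial_iff_subsingleton] at hV
      refine bot_ne_top (α := Subrepresentation ρ) ?_
      apply Subrepresentation.toSubmodule_injective
      exact Subsingleton.elim _ _
    obtain ⟨v, hv⟩ := exists_ne (0 : V)
    have h1 : (a : K) • v = (b : K) • v :=
      congrArg (fun x : ρ.autLift => x.1.2 v) h
    exact Units.ext (smul_left_injective K hv h1)
  range_inl_eq_ker_rightHom := by
    ext x
    constructor
    · rintro ⟨a, rfl⟩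
      rfl
    · intro hx
      obtain ⟨⟨σ, φ⟩, h⟩ := x
      have hσ : σ = 1 := hx
      subst hσ
      let f : IntertwiningMap ρ ρ := ⟨φ.toLinearMap, fun γ => LinearMap.ext (h γ)⟩
      obtain ⟨a, ha⟩ :=
        (IsIrreducible.algebraMap_intertwiningMap_bijective_of_isAlgClosed (ρ := ρ)).2 f
      have ha' : ∀ v, a • v = φ v := fun v => congrArg (fun F : IntertwiningMap ρ ρ => F v) ha
      have ha0 : a ≠ 0 := by
        rintro rfl
        refine bot_ne_top (α := Subrepresentation ρ) ?_
        apply Subrepresentation.toSubmodule_injective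
        have : Subsingleton V := ⟨fun v w => φ.injective (by rw [← ha' v, ← ha' w]; simp)⟩
        exact Subsingleton.elim _ _
      refine ⟨Units.mk0 a ha0, ?_⟩
      apply Subtype.ext
      refine Prod.ext rfl ?_
      ext v
      exact ha' v
  rightHom_surjective := by
    rintro ⟨σ, ⟨f⟩⟩
    exact ⟨⟨(⟨σ, ⟨f⟩⟩, f.toLinearEquiv), fun γ v => IntertwiningMap.isIntertwining _ _ f.toIntertwiningMap γ v⟩, rfl⟩

theorem autExtension_isCentral [IsAlgClosed K] [FiniteDimensional K V]
    (ρ : Representation K Γ V) [ρ.IsIrreducible] :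
    CentralExtension.IsCentral ρ.autExtension := by
  rintro _ ⟨a, rfl⟩
  rw [Subgroup.mem_center_iff]
  intro x
  apply Subtype.ext
  refine Prod.ext ((mul_one _).trans (one_mul _).symm) ?_
  ext v
  exact x.1.2.map_smul (a : K) v

end

/-- The class `α_ρ ∈ H²(Aut_ρ(Γ), K^×)` of the central extension of `Aut_ρ(Γ)` by `K^×`
attached to an irreducible representation `ρ` of `Γ`. -/
noncomputable def autClass {K Γ : Type} {V : Type*} [Field K] [Group Γ] [AddCommGroup V]
    [Module K V] [IsAlgClosed K] [FiniteDimensional K V] (ρ : Representation K Γ V)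
    [ρ.IsIrreducible] :
    groupCohomology.H2 (CentralExtension.trivialCoeff ρ.autStabilizer Kˣ) :=
  CentralExtension.extensionClass ρ.autExtension_isCentral

end Representation

/-! Let `F = ℚ(ζ)` with `ζ` a primitive `p ^ r`-th root of unity, and let `n = dim V`. By
`exists_basis_mem_span`, `ρ` preserves the `F`-span `V₀` of some basis, and `n` divides the order of
`Γ`, so it is a power of `p`. By `exists_intertwiner_mem_span` every intertwiner `φ_σ` can be scaled
to preserve `V₀`. The resulting cocycle `f` then has values in `A = F^×`, and determinants give `f ^
n = ∂c` with `c σ = det φ_σ` in `A`.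

The `n`-torsion of `A` lies in `μ = μ_{p^r}`, by comparing degrees of cyclotomic fields. Since
`K^×/μ` is divisible, there is a homomorphism `R : A → K^×/μ` with `R (x ^ n) = x mod μ`. Hence `f
mod μ = R (f ^ n) = ∂(R ∘ c)`. Lifting `R ∘ c` to a cochain `b` in `K^×`, the cocycle `f / ∂b` takes
values in `μ` and has the same class as `f`. -/

/-! ### Divisible groups and reduction of cocycles to a subgroup -/

/-- Homomorphisms into a divisible abelian group extend along homomorphisms with smaller kernel. -/
theorem MonoidHom.exists_comp_eq_of_ker_le {A B Q : Type} [CommGroup A] [CommGroup B]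
    [CommGroup Q] (hQ : ∀ n : ℕ, n ≠ 0 → ∀ x : Q, ∃ y, y ^ n = x) (f : A →* B) (g : A →* Q)
    (hfg : f.ker ≤ g.ker) : ∃ h : B →* Q, ∀ a, h (f a) = g a := by
  have : ∀ {n : ℤ}, n ≠ 0 → Function.Surjective fun a : Additive Q => n • a := by
    intro n hn x
    obtain ⟨y, hy⟩ := hQ n.natAbs (Int.natAbs_ne_zero.2 hn) x.toMul
    rcases Int.natAbs_eq n with h | h
    · refine ⟨Additive.ofMul y, ?_⟩
      have : Additive.ofMul (y ^ n) = x := by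
        rw [h, zpow_natCast, hy]; rfl
      exact this
    · refine ⟨Additive.ofMul y⁻¹, ?_⟩
      have : Additive.ofMul (y⁻¹ ^ n) = x := by
        rw [h, zpow_neg, inv_zpow, inv_inv, zpow_natCast, hy]; rfl
      exact this
  let : DivisibleBy (Additive Q) ℤ := divisibleByOfSMulRightSurj _ _ this
  -- Divisible groups are injective. To extend along an injection, both maps are first factored
  -- through the quotient by `f.ker`.
  obtain ⟨h, hh⟩ := (Module.Baer.of_divisible (Additive Q)).extension_property_addMonoidHom
    (MonoidHom.toAdditive (QuotientGroup.kerLift f)) (QuotientGroup.kerLift_injective f)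
    (MonoidHom.toAdditive (QuotientGroup.lift f.ker g hfg))
  refine ⟨MonoidHom.toAdditive.symm h, fun a => ?_⟩
  exact DFunLike.congr_fun hh (Additive.ofMul (a : A ⧸ f.ker))

namespace CentralExtension

variable {N G : Type} {E : Type*} [CommGroup N] [Group E] [Group G] {S : GroupExtension N E G}

theorem factorSet_eq_of_inl_mul (s : S.Section) {g h : G} {n : N}
    (H : S.inl n * s (g * h) = s g * s h) : factorSet S s (g, h) = n :=
  S.inl_injective (mul_right_cancel ((inl_factorSet_mul S s g h).trans H.symm))

/-- A central extension admitting a section whose factor set takes values in a subgroup `M` has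
class in the image of `H²(G, M)`. -/
theorem extensionClass_mem_range_of_factorSet_mem (hS : IsCentral S) (M : Subgroup N)
    (s : S.Section) (hs : ∀ x, factorSet S s x ∈ M) :
    extensionClass hS ∈ LinearMap.range (cohomologyMap G M.subtype 2) := by
  let c : groupCohomology.cocycles₂ (trivialCoeff G M) :=
    ⟨fun x => (Additive.ofMul (⟨factorSet S s x, hs x⟩ : M) : Additive M), by
      rw [groupCohomology.mem_cocycles₂_iff]
      intro g h j
      exact congrArg Additive.ofMul (Subtype.ext (factorSet_cocycle hS s g h j))⟩
  refine ⟨groupCohomology.H2π _ c, ?_⟩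
  have h := congrArg (fun f => f.hom c)
    (groupCohomology.H2π_comp_map (MonoidHom.id G) (trivialCoeffMap G M.subtype))
  refine h.trans ?_
  rw [extensionClass, sectionClass_eq hS _ s, sectionClass]
  refine congrArg (groupCohomology.H2π (trivialCoeff G N)).hom ?_
  apply Subtype.ext
  rfl

/-- Suppose that the factor set `f` of a section takes values in a subgroup `A`, that `f ^ n` is
the coboundary of an `A`-valued cochain, and that the `n`-torsion of `A` lies in `M`. If the
coefficient group is divisible, then the class comes from `H²(G, M)`. -/
theorem extensionClass_mem_range_of_pow_eq_coboundary (hS : IsCentral S)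
    (hN : ∀ n : ℕ, n ≠ 0 → ∀ x : N, ∃ y, y ^ n = x) (A M : Subgroup N) (n : ℕ)
    (hAM : ∀ x ∈ A, x ^ n = 1 → x ∈ M) (s : S.Section) (hs : ∀ x, factorSet S s x ∈ A)
    (c : G → N) (hcA : ∀ g, c g ∈ A)
    (hc : ∀ g h, factorSet S s (g, h) ^ n * c (g * h) = c g * c h) :
    extensionClass hS ∈ LinearMap.range (cohomologyMap G M.subtype 2) := by
  -- `R` is an `n`-th root modulo `M`, chosen multiplicatively on all of `A`: `R (x ^ n) = x mod M`.
  obtain ⟨R, hR⟩ := MonoidHom.exists_comp_eq_of_ker_le (Q := N ⧸ M)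
    (by
      intro k hk x
      obtain ⟨x, rfl⟩ := QuotientGroup.mk_surjective x
      obtain ⟨y, rfl⟩ := hN k hk x
      exact ⟨y, rfl⟩)
    (powMonoidHom n : A →* A) ((QuotientGroup.mk' M).comp A.subtype) (by
      intro x hx
      rw [MonoidHom.mem_ker] at hx ⊢
      exact (QuotientGroup.eq_one_iff _).2 (hAM x x.2 (congrArg Subtype.val hx)))
  choose b hb using fun g => QuotientGroup.mk_surjective (R ⟨c g, hcA g⟩)
  let t : S.Section := ⟨fun g => S.inl (b g)⁻¹ * s g, fun g => by simp⟩
  refine extensionClass_mem_range_of_factorSet_mem hS M t ?_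
  rintro ⟨g, h⟩
  have ht : factorSet S t (g, h) = factorSet S s (g, h) * b (g * h) * (b g)⁻¹ * (b h)⁻¹ := by
    apply factorSet_eq_of_inl_mul
    change _ * (S.inl (b (g * h))⁻¹ * s (g * h)) = S.inl (b g)⁻¹ * s g * (S.inl (b h)⁻¹ * s h)
    rw [mul_assoc (S.inl (b g)⁻¹), ← mul_assoc (s g), hS.comm, mul_assoc _ (s g),
      ← inl_factorSet_mul S s g h]
    simp only [← mul_assoc, ← map_mul]
    congr 2
    rw [mul_inv_eq_iff_eq_mul]
    ac_rfl
  rw [ht, ← QuotientGroup.eq_one_iff]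
  have h1 : R ⟨factorSet S s (g, h), hs _⟩ ^ n * R ⟨c (g * h), hcA _⟩
      = R ⟨c g, hcA g⟩ * R ⟨c h, hcA h⟩ := by
    rw [← map_pow, ← map_mul, ← map_mul]
    exact congrArg R (Subtype.ext (hc g h))
  rw [← map_pow] at h1
  have h2 := hR ⟨factorSet S s (g, h), hs _⟩
  rw [powMonoidHom_apply] at h2
  rw [h2, ← hb, ← hb, ← hb] at h1
  have h3 : ((factorSet S s (g, h) * b (g * h) : N) : N ⧸ M) = ((b g * b h : N) : N ⧸ M) := h1
  rw [mul_assoc, ← mul_inv, QuotientGroup.mk_mul, h3, ← QuotientGroup.mk_mul, mul_inv_cancel,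
    QuotientGroup.mk_one]

end CentralExtension

/-! ### Irreducible representations of `p`-groups over a subfield -/

namespace Representation

section

universe u v

variable {K : Type v} [Field K]

theorem isIrreducible_iff_forall_submodule {Γ V : Type*} [Group Γ] [AddCommGroup V] [Module K V]
    (ρ : Representation K Γ V) :
    ρ.IsIrreducible ↔ Nontrivial V ∧
      ∀ U : Submodule K V, (∀ γ, ∀ v ∈ U, ρ γ v ∈ U) → U = ⊥ ∨ U = ⊤ := by
  constructor
  · intro h
    refine ⟨?_, fun U hU => ?_⟩
    · by_contra hV
      rw [not_nontrivial_iff_subsingleton] at hV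
      exact bot_ne_top (α := Subrepresentation ρ)
        (Subrepresentation.toSubmodule_injective (Subsingleton.elim _ _))
    · exact (eq_bot_or_eq_top (⟨U, fun γ v hv => hU γ v hv⟩ : Subrepresentation ρ)).imp
        (congrArg Subrepresentation.toSubmodule) (congrArg Subrepresentation.toSubmodule)
  · rintro ⟨hV, h⟩
    refine { exists_pair_ne := ⟨⊥, ⊤, fun e => ?_⟩, eq_bot_or_eq_top := fun U => ?_ }
    · exact bot_ne_top (α := Submodule K V) (congrArg Subrepresentation.toSubmodule e)
    · exact (h U.toSubmodule fun γ v hv => U.apply_mem_toSubmodule γ hv).imp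
        (fun e => Subrepresentation.toSubmodule_injective e)
        (fun e => Subrepresentation.toSubmodule_injective e)

/-- Schur's lemma: an endomorphism commuting with an irreducible representation is a scalar. -/
theorem IsIrreducible.exists_eq_smul_of_commute [IsAlgClosed K] {Γ V : Type*} [Group Γ]
    [AddCommGroup V] [Module K V] [FiniteDimensional K V] (ρ : Representation K Γ V)
    [ρ.IsIrreducible] (f : V →ₗ[K] V) (hf : ∀ γ v, f (ρ γ v) = ρ γ (f v)) :
    ∃ a : K, ∀ v, f v = a • v := by
  obtain ⟨a, ha⟩ := (IsIrreducible.algebraMap_intertwiningMap_bijective_of_isAlgClosed (ρ := ρ)).2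
    ⟨f, fun γ => LinearMap.ext (hf γ)⟩
  exact ⟨a, fun v => (congrArg (fun F : IntertwiningMap ρ ρ => F v) ha).symm⟩

/-- A representation of a group on a nonzero invariant subspace contains an irreducible one. -/
theorem exists_isIrreducible_subrepresentation {Γ V : Type*} [Group Γ] [AddCommGroup V]
    [Module K V] [FiniteDimensional K V] (ρ : Representation K Γ V) (W : Subrepresentation ρ)
    (hW : W.toSubmodule ≠ ⊥) :
    ∃ N : Subrepresentation ρ, N.toSubmodule ≤ W.toSubmodule ∧
      N.toRepresentation.IsIrreducible := by
  obtain ⟨N, ⟨hN0, hNW, hNs⟩, hmin⟩ := WellFounded.has_min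
    (wellFounded_lt : WellFounded ((· < ·) : Submodule K V → Submodule K V → Prop))
    {N | N ≠ ⊥ ∧ N ≤ W.toSubmodule ∧ ∀ γ, ∀ v ∈ N, ρ γ v ∈ N}
    ⟨W.toSubmodule, hW, le_rfl, fun γ v hv => W.apply_mem_toSubmodule γ hv⟩
  refine ⟨⟨N, fun γ v hv => hNs γ v hv⟩, hNW, ?_⟩
  rw [isIrreducible_iff_forall_submodule]
  refine ⟨Submodule.nontrivial_iff_ne_bot.2 hN0, fun U hU => ?_⟩
  change Submodule K N at U
  by_cases hU0 : U = ⊥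
  · exact Or.inl hU0
  · right
    have hle : U.map N.subtype ≤ N := Submodule.map_subtype_le N U
    have h := hmin (U.map N.subtype) ⟨?_, hle.trans hNW, ?_⟩
    · have h2 : U.map N.subtype = N := by
        by_contra hne
        exact h (lt_of_le_of_ne hle hne)
      apply Submodule.map_injective_of_injective N.injective_subtype
      rw [h2, Submodule.map_top, Submodule.range_subtype]
    · exact fun h0 => hU0 (Submodule.map_injective_of_injective N.injective_subtype
        (h0.trans (Submodule.map_bot _).symm))
    · rintro γ _ ⟨v, hv, rfl⟩
      exact ⟨_, hU γ v hv, rfl⟩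

/-- In an irreducible representation of a `p`-group that is not by scalars, some element acts
by a non-scalar operator whose class modulo scalars is central. -/
theorem IsIrreducible.exists_quasicentral [IsAlgClosed K] {p : ℕ} [Fact p.Prime] {Γ V : Type*}
    [Group Γ] [Finite Γ] [AddCommGroup V] [Module K V] [FiniteDimensional K V] (hΓ : IsPGroup p Γ)
    (ρ : Representation K Γ V) [ρ.IsIrreducible]
    (hρ : ¬ ∀ γ, ∃ c : K, ∀ v, ρ γ v = c • v) :
    ∃ a, (¬ ∃ c : K, ∀ v, ρ a v = c • v) ∧
      ∃ χ : Γ →* Kˣ, ∀ γ v, ρ a (ρ γ v) = (χ γ : K) • ρ γ (ρ a v) := by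
  obtain ⟨hV, -⟩ := (isIrreducible_iff_forall_submodule ρ).1 ‹_›
  have hinv : ∀ γ v, ρ γ⁻¹ (ρ γ v) = v := fun γ v => by simp
  have hinv' : ∀ γ v, ρ γ (ρ γ⁻¹ v) = v := fun γ v => by simp
  have hmul : ∀ γ δ v, ρ (γ * δ) v = ρ γ (ρ δ v) := fun γ δ v => by simp
  have hne : ∀ {c : K} {γ}, (∀ v, ρ γ v = c • v) → c ≠ 0 := by
    rintro c γ h rfl
    obtain ⟨v, hv⟩ := exists_ne (0 : V)
    apply hv
    rw [← hinv γ v, h, zero_smul, map_zero]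
  let Z : Subgroup Γ :=
    { carrier := {γ | ∃ c : K, ∀ v, ρ γ v = c • v}
      one_mem' := ⟨1, fun v => by simp⟩
      mul_mem' := by
        rintro x y ⟨c, hc⟩ ⟨d, hd⟩
        exact ⟨c * d, fun v => by rw [hmul, hd, hc, mul_smul]⟩
      inv_mem' := by
        rintro x ⟨c, hc⟩
        refine ⟨c⁻¹, fun v => ?_⟩
        rw [eq_inv_smul_iff₀ (hne hc), ← hc, hinv'] }
  have hZ : Z.Normal := ⟨by
    rintro x ⟨c, hc⟩ g
    exact ⟨c, fun v => by rw [hmul, hmul, hc, map_smul, hinv']⟩⟩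
  have hnt : Nontrivial (Γ ⧸ Z) := by
    rw [QuotientGroup.nontrivial_iff]
    intro h
    exact hρ fun γ => (h ▸ Subgroup.mem_top γ : γ ∈ Z)
  -- `Z` is the subgroup acting by scalars. A nontrivial `p`-group has nontrivial center, and `a`
  -- lifts a nontrivial central element of `Γ ⧸ Z`.
  have := (hΓ.to_quotient Z).center_nontrivial
  obtain ⟨⟨a', ha'⟩, hane⟩ := exists_ne (1 : Subgroup.center (Γ ⧸ Z))
  obtain ⟨a, rfl⟩ := QuotientGroup.mk_surjective a'
  refine ⟨a, fun h => hane (Subtype.ext ((QuotientGroup.eq_one_iff a).2 h)), ?_⟩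
  have hχ : ∀ γ, ∃ c : Kˣ, ∀ v, ρ a (ρ γ v) = (c : K) • ρ γ (ρ a v) := by
    intro γ
    have h1 : ((γ * a : Γ) : Γ ⧸ Z) = (a * γ : Γ) := Subgroup.mem_center_iff.1 ha' γ
    obtain ⟨c, hc⟩ := QuotientGroup.eq.1 h1
    refine ⟨Units.mk0 c (hne hc), fun v => ?_⟩
    have h2 : a * γ = (γ * a) * ((γ * a)⁻¹ * (a * γ)) := by group
    calc ρ a (ρ γ v) = ρ (γ * a) (ρ ((γ * a)⁻¹ * (a * γ)) v) := by rw [← hmul, ← hmul, ← h2]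
      _ = c • ρ γ (ρ a v) := by rw [hc, map_smul, hmul]
  choose χ hχ using hχ
  refine ⟨MonoidHom.mk' χ fun γ δ => ?_, hχ⟩
  obtain ⟨v, hv⟩ := exists_ne (0 : V)
  have h0 : ρ (γ * δ) (ρ a v) ≠ 0 := by
    intro h
    apply hv
    rw [← hinv a v, ← hinv (γ * δ) (ρ a v), h, map_zero, map_zero]
  apply Units.ext
  apply smul_left_injective K h0
  change (χ (γ * δ) : K) • ρ (γ * δ) (ρ a v) = ((χ γ * χ δ : Kˣ) : K) • ρ (γ * δ) (ρ a v)
  rw [← hχ, hmul, hχ, hχ, map_smul, smul_smul, hmul, Units.val_mul]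

/-- An irreducible representation of a finite `p`-group of exponent dividing `m` is defined over
any subfield containing the `m`-th roots of unity, and its dimension divides the group order. -/
theorem IsIrreducible.exists_basis_mem_span [IsAlgClosed K] {p : ℕ} [Fact p.Prime]
    (F : Subfield K) (m : ℕ) (hF : ∀ x : K, x ^ m = 1 → x ∈ F) (n : ℕ) :
    ∀ {Γ : Type} [Group Γ] [Finite Γ] {V : Type u} [AddCommGroup V] [Module K V]
      [FiniteDimensional K V] (_ : Nat.card Γ = n) (_ : IsPGroup p Γ) (_ : ∀ γ : Γ, γ ^ m = 1)
      (ρ : Representation K Γ V) [ρ.IsIrreducible],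
    ∃ (ι : Type v) (_ : Fintype ι) (b : Module.Basis ι K V),
      Fintype.card ι ∣ Nat.card Γ ∧ ∀ γ i, ρ γ (b i) ∈ Submodule.span F (Set.range b) := by
  induction n using Nat.strong_induction_on with
  | _ n ih =>
  intro Γ _ _ V _ _ _ hn hΓ hm ρ _
  obtain ⟨hV, hirr⟩ := (isIrreducible_iff_forall_submodule ρ).1 ‹_›
  by_cases hsc : ∀ γ, ∃ c : K, ∀ v, ρ γ v = c • v
  · obtain ⟨v, hv⟩ := exists_ne (0 : V)
    have htop : Submodule.span K {v} = ⊤ := by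
      refine (hirr _ fun γ w hw => ?_).resolve_left
        (fun h => hv (Submodule.span_singleton_eq_bot.1 h))
      obtain ⟨c, hc⟩ := hsc γ
      rw [hc]
      exact Submodule.smul_mem _ c hw
    let b : Module.Basis PUnit.{v + 1} K V := Module.Basis.mk (v := fun _ => v)
      (linearIndependent_unique_iff.2 hv) (by rw [Set.range_const, htop])
    refine ⟨PUnit, inferInstance, b, by simp, fun γ i => ?_⟩
    obtain ⟨c, hc⟩ := hsc γ
    have hpow : ∀ k : ℕ, ρ (γ ^ k) v = c ^ k • v := by
      intro k
      induction k with
      | zero => simp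
      | succ k ihk => rw [pow_succ, map_mul, Module.End.mul_apply, hc, map_smul, ihk, smul_smul,
          pow_succ, mul_comm]
    have hcF : c ∈ F := by
      apply hF
      apply smul_left_injective K hv
      change c ^ m • v = (1 : K) • v
      rw [← hpow, hm, map_one, one_smul, Module.End.one_apply]
    rw [hc]
    exact Submodule.smul_mem _ (⟨c, hcF⟩ : F) (Submodule.subset_span ⟨i, rfl⟩)
  -- Clifford theory: `Γ` permutes the eigenspaces of `ρ a` through `χ`, so `V` is induced from an
  -- irreducible representation `N` of `H = χ.ker` inside one eigenspace. The induction hypothesis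
  -- applies to `N`, and translates of its basis give a basis of `V`.
  · obtain ⟨a, ha, χ, hχ⟩ := IsIrreducible.exists_quasicentral hΓ ρ hsc
    have hinv : ∀ γ v, ρ γ⁻¹ (ρ γ v) = v := fun γ v => by simp
    have hmul : ∀ γ δ v, ρ (γ * δ) v = ρ γ (ρ δ v) := fun γ δ v => by simp
    have hinj : ∀ γ, Function.Injective (ρ γ) := fun γ => Function.LeftInverse.injective (hinv γ)
    obtain ⟨c, hc⟩ := Module.End.exists_eigenvalue (ρ a)
    have hc0 : c ≠ 0 := by
      rintro rfl
      obtain ⟨v, hv⟩ := hc.exists_hasEigenvector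
      apply hv.2
      rw [← hinv a v, hv.apply_eq_smul, zero_smul, map_zero]
    have hmem : ∀ γ d v, v ∈ Module.End.eigenspace (ρ a) d →
        ρ γ v ∈ Module.End.eigenspace (ρ a) (χ γ * d) := by
      intro γ d v hv
      rw [Module.End.mem_eigenspace_iff] at hv ⊢
      rw [hχ, hv, map_smul, smul_smul]
    let H := χ.ker
    let W : Subrepresentation (MonoidHom.comp ρ H.subtype : Representation K H V) :=
      ⟨Module.End.eigenspace (ρ a) c, fun h v hv => by
        have := hmem h c v hv
        rwa [show χ h = 1 from h.2, Units.val_one, one_mul] at this⟩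
    obtain ⟨N, hNW, hN⟩ := exists_isIrreducible_subrepresentation _ W hc
    have hNs : ∀ h, χ h = 1 → ∀ v ∈ N.toSubmodule, ρ h v ∈ N.toSubmodule := fun h hh v hv =>
      N.apply_mem_toSubmodule ⟨h, hh⟩ hv
    have hcard : Nat.card χ.range * Nat.card H = Nat.card Γ := by
      rw [mul_comm, ← Subgroup.index_ker, Subgroup.card_mul_index]
    have hlt : Nat.card H < n := by
      rw [← hn]
      refine lt_of_le_of_ne (Nat.le_of_dvd Nat.card_pos ⟨_, (mul_comm _ _).trans hcard |>.symm⟩) ?_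
      -- If `H` were all of `Γ`, the eigenspace would be invariant, hence all of `V`, and `ρ a`
      -- would be scalar.
      intro he
      have hH : H = ⊤ := Subgroup.eq_top_of_card_eq _ he
      refine (hirr (Module.End.eigenspace (ρ a) c) fun γ v hv => ?_).elim hc fun h => ?_
      · exact W.apply_mem_toSubmodule ⟨γ, hH ▸ Subgroup.mem_top γ⟩ hv
      · exact ha ⟨c, fun v => Module.End.mem_eigenspace_iff.1 (h ▸ Submodule.mem_top)⟩
    obtain ⟨ι, _, b, hb, hbs⟩ := ih _ hlt (Γ := H) rfl (hΓ.to_subgroup H)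
      (fun γ => Subtype.ext (hm γ)) N.toRepresentation
    choose g hg using fun t : χ.range => t.2
    let U : χ.range → Submodule K V := fun t => N.toSubmodule.map (ρ (g t))
    have hstep : ∀ δ t, ∃ t' : χ.range, ∃ h : H, δ * g t = g t' * h := by
      intro δ t
      refine ⟨⟨χ (δ * g t), ⟨_, rfl⟩⟩, ⟨(g ⟨χ (δ * g t), ⟨_, rfl⟩⟩)⁻¹ * (δ * g t), ?_⟩, ?_⟩
      · rw [MonoidHom.mem_ker, map_mul, map_inv, hg, inv_mul_cancel]
      · simp
    have hle : ∀ t, U t ≤ Module.End.eigenspace (ρ a) (((t : Kˣ) : K) * c) := by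
      rintro t _ ⟨v, hv, rfl⟩
      rw [← hg t]
      exact hmem _ _ _ (hNW hv)
    -- The translates lie in eigenspaces for the distinct eigenvalues `t * c`.
    have hind : iSupIndep U := by
      refine iSupIndep.mono (iSupIndep.comp (Module.End.eigenspaces_iSupIndep (ρ a))
        (f := fun t : χ.range => ((t : Kˣ) : K) * c) ?_) hle
      intro t t' h
      exact Subtype.ext (Units.ext (mul_right_cancel₀ hc0 h))
    have htop : ⨆ t, U t = ⊤ := by
      refine (hirr _ fun γ => ?_).resolve_left fun h => ?_
      · change ⨆ t, U t ≤ (⨆ t, U t).comap (ρ γ)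
        refine iSup_le fun t => ?_
        rintro _ ⟨v, hv, rfl⟩
        obtain ⟨t', h, hh⟩ := hstep γ t
        rw [Submodule.mem_comap, ← hmul, hh, hmul]
        exact Submodule.mem_iSup_of_mem t' ⟨_, hNs h h.2 v hv, rfl⟩
      · have h1 : U 1 = ⊥ := eq_bot_iff.2 (h ▸ le_iSup U 1)
        replace h1 := Submodule.map_injective_of_injective (hinj _)
          (h1.trans (Submodule.map_bot _).symm)
        obtain ⟨hNn, -⟩ := (isIrreducible_iff_forall_submodule N.toRepresentation).1 hN
        exact Submodule.nontrivial_iff_ne_bot.1 hNn h1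
    classical
    have hint := DirectSum.isInternal_submodule_of_iSupIndep_of_iSup_eq_top hind htop
    let B := hint.collectedBasis
      fun t => b.map (Submodule.equivMapOfInjective (ρ (g t)) (hinj _) N.toSubmodule)
    have hB : ∀ t i, B ⟨t, i⟩ = ρ (g t) (b i : V) := fun t i => by
      simp only [B, DirectSum.IsInternal.collectedBasis_coe, Module.Basis.map_apply]
      exact Submodule.coe_equivMapOfInjective_apply _ _ _ _
    have : Finite χ.range := Finite.of_surjective _ χ.rangeRestrict_surjective
    have : Fintype χ.range := Fintype.ofFinite _
    refine ⟨(_ : χ.range) × ι, inferInstance, B, ?_, ?_⟩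
    · rw [Fintype.card_sigma, Finset.sum_const, smul_eq_mul, Finset.card_univ, ← hcard,
        Nat.card_eq_fintype_card (α := χ.range)]
      exact mul_dvd_mul_left _ hb
    · rintro δ ⟨t, i⟩
      obtain ⟨t', h, hh⟩ := hstep δ t
      rw [hB, ← hmul, hh, hmul]
      have h1 := Submodule.mem_map_of_mem
        (f := (ρ (g t')).restrictScalars F ∘ₗ N.toSubmodule.subtype.restrictScalars F) (hbs h i)
      rw [Submodule.map_span, ← Set.range_comp] at h1
      refine Submodule.span_mono ?_ h1
      rintro _ ⟨j, rfl⟩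
      exact ⟨⟨t', j⟩, hB t' j⟩

end

end Representation

/-! ### Linear algebra over a subfield -/

/-- At a nonzero coordinate of `w`, `a` is a quotient of two elements of `F`. This forces the values
of the cocycle into `F`. -/
theorem Module.Basis.mem_of_smul_mem_span {K V ι : Type*} [Field K] [AddCommGroup V] [Module K V]
    (F : Subfield K) (b : Module.Basis ι K V) {a : K} {w : V} (hw0 : w ≠ 0)
    (hw : w ∈ Submodule.span F (Set.range b)) (haw : a • w ∈ Submodule.span F (Set.range b)) :
    a ∈ F := by
  rw [b.mem_span_iff_repr_mem F] at hw haw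
  obtain ⟨j, hj⟩ : ∃ j, b.repr w j ≠ 0 := by
    by_contra! h
    exact hw0 (b.ext_elem_iff.2 fun j => by simpa using h j)
  obtain ⟨x, hx⟩ := hw j
  obtain ⟨y, hy⟩ := haw j
  rw [map_smul, Finsupp.smul_apply, smul_eq_mul] at hy
  rw [eq_div_of_mul_eq hj hy.symm, ← hx]
  exact F.div_mem y.2 x.2

theorem Module.Basis.det_mem_of_mem_span {K V ι : Type*} [Field K] [AddCommGroup V] [Module K V]
    [Fintype ι] (F : Subfield K) (b : Module.Basis ι K V) (f : V →ₗ[K] V)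
    (hf : ∀ i, f (b i) ∈ Submodule.span F (Set.range b)) : LinearMap.det f ∈ F := by
  classical
  rw [← LinearMap.det_toMatrix b, Matrix.det_apply]
  refine sum_mem fun σ _ => ?_
  rw [Units.smul_def]
  refine zsmul_mem (prod_mem fun i _ => ?_) _
  rw [LinearMap.toMatrix_apply]
  obtain ⟨x, hx⟩ := (b.mem_span_iff_repr_mem _ _).1 (hf i) (σ i)
  rw [← hx]
  exact x.2

theorem LinearMap.mem_span_of_forall_basis_mem_span {K V ι : Type*} [Field K] [AddCommGroup V]
    [Module K V] (F : Subfield K) (b : ι → V) (f : V →ₗ[K] V)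
    (hf : ∀ i, f (b i) ∈ Submodule.span F (Set.range b)) {w : V}
    (hw : w ∈ Submodule.span F (Set.range b)) : f w ∈ Submodule.span F (Set.range b) := by
  have : Submodule.span F (Set.range b) ≤
      (Submodule.span F (Set.range b)).comap (f.restrictScalars F) := by
    rw [Submodule.span_le]
    rintro _ ⟨i, rfl⟩
    exact hf i
  exact this hw

/-! ### Intertwiners over the subfield, and the class of `ρ` -/

namespace Representation

/-- If `ρ` is defined over a subfield `F`, so are the intertwiners from `ρ` to its twists. -/
theorem exists_intertwiner_mem_span {K Γ V ι : Type*} [Field K] [IsAlgClosed K] [Group Γ]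
    [AddCommGroup V] [Module K V] [FiniteDimensional K V] (ρ : Representation K Γ V)
    [ρ.IsIrreducible] [Fintype ι] (F : Subfield K) (b : Module.Basis ι K V)
    (hb : ∀ γ i, ρ γ (b i) ∈ Submodule.span F (Set.range b)) (σ : ρ.autStabilizer) :
    ∃ φ : V ≃ₗ[K] V, (∀ γ v, φ (ρ γ v) = ρ (σ.1 γ) (φ v)) ∧
      ∀ i, φ (b i) ∈ Submodule.span F (Set.range b) := by
  obtain ⟨f⟩ := σ.2
  let φ := f.toLinearEquiv
  have hφ : ∀ γ v, φ (ρ γ v) = ρ (σ.1 γ) (φ v) := fun γ v =>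
    IntertwiningMap.isIntertwining _ _ f.toIntertwiningMap γ v
  obtain ⟨hV, -⟩ := (isIrreducible_iff_forall_submodule ρ).1 ‹_›
  obtain ⟨i₀⟩ := b.index_nonempty
  obtain ⟨j₀, hj₀⟩ : ∃ j, b.repr (φ (b i₀)) j ≠ 0 := by
    by_contra! h
    have : φ (b i₀) = 0 := b.ext_elem_iff.2 fun j => by simpa using h j
    exact b.ne_zero i₀ (φ.map_eq_zero_iff.1 this)
  -- Applying an `F`-linear `π : K → F` to the matrix entries of `φ` preserves the intertwining
  -- relation, since the matrices of `ρ` have entries in `F`. Taking `π` nonzero on one entry of `φ`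
  -- keeps the result nonzero.
  obtain ⟨π, hπ⟩ := Module.Projective.exists_dual_ne_zero F hj₀
  let P : V →ₗ[F] V :=
    { toFun := fun v => ∑ j, π (b.repr v j) • b j
      map_add' := fun v w => by simp [add_smul, Finset.sum_add_distrib]
      map_smul' := fun x v => by
        have : ∀ j, b.repr (x • v) j = x • b.repr v j := fun j => by
          change b.repr ((x : K) • v) j = (x : K) • b.repr v j
          rw [map_smul, Finsupp.smul_apply]
        simp only [this, map_smul, smul_assoc, Finset.smul_sum, RingHom.id_apply] }
  have hPapply : ∀ v, P v = ∑ j, π (b.repr v j) • b j := fun v => rfl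
  have hPmem : ∀ v, P v ∈ Submodule.span F (Set.range b) := fun v =>
    sum_mem fun j _ => Submodule.smul_mem _ _ (Submodule.subset_span ⟨j, rfl⟩)
  have hPsmul : ∀ (x : K), ∀ w ∈ Submodule.span F (Set.range b), P (x • w) = π x • w := by
    intro x w hw
    induction hw using Submodule.span_induction with
    | mem w hw =>
      classical
      obtain ⟨j, rfl⟩ := hw
      rw [hPapply, Finset.sum_eq_single j]
      · simp
      · intro k _ hk
        simp [Finsupp.single_eq_of_ne hk]
      · simp
    | zero => simp
    | add v w _ _ hv hw => rw [smul_add, map_add, hv, hw, smul_add]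
    | smul a w _ hw => rw [smul_comm, map_smul, hw, smul_comm]
  have hPcomm : ∀ δ v, P (ρ δ v) = ρ δ (P v) := by
    intro δ v
    rw [← b.sum_repr v]
    simp only [map_sum, map_smul]
    refine Finset.sum_congr rfl fun i _ => ?_
    rw [hPsmul _ _ (hb δ i), hPsmul _ _ (Submodule.subset_span ⟨i, rfl⟩)]
    exact ((ρ δ).map_smul (π (b.repr v i) : K) (b i)).symm
  let ψ : V →ₗ[K] V := b.constr K fun i => P (φ (b i))
  have hψb : ∀ i, ψ (b i) = P (φ (b i)) := fun i => b.constr_basis K _ i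
  have hψ : ∀ w ∈ Submodule.span F (Set.range b), ψ w = P (φ w) := by
    intro w hw
    induction hw using Submodule.span_induction with
    | mem w hw => obtain ⟨i, rfl⟩ := hw; exact hψb i
    | zero => simp
    | add v w _ _ hv hw => simp only [map_add, hv, hw]
    | smul a w _ hw =>
      have h1 : ψ (a • w) = a • ψ w := ψ.map_smul (a : K) w
      have h2 : φ (a • w) = a • φ w := φ.map_smul (a : K) w
      rw [h1, h2, map_smul, hw]
  have hψρ : ∀ γ v, ψ (ρ γ v) = ρ (σ.1 γ) (ψ v) := by
    intro γ v
    have : ψ ∘ₗ ρ γ = ρ (σ.1 γ) ∘ₗ ψ := b.ext fun i => by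
      rw [LinearMap.comp_apply, LinearMap.comp_apply, hψ _ (hb γ i), hψb, hφ, hPcomm]
    exact LinearMap.congr_fun this v
  -- By Schur, `ψ = a • φ`. The scalar is nonzero by the choice of `π`, so `a • φ` is the required
  -- invertible intertwiner.
  obtain ⟨a, ha⟩ := IsIrreducible.exists_eq_smul_of_commute ρ (φ.symm.toLinearMap ∘ₗ ψ)
    (by
      intro γ v
      change φ.symm (ψ (ρ γ v)) = ρ γ (φ.symm (ψ v))
      rw [LinearEquiv.symm_apply_eq, hψρ, hφ, LinearEquiv.apply_symm_apply])
  have ha' : ∀ v, ψ v = a • φ v := fun v => by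
    have := ha v
    rw [LinearMap.comp_apply, LinearEquiv.coe_coe, LinearEquiv.symm_apply_eq, map_smul] at this
    exact this
  have ha0 : a ≠ 0 := by
    rintro rfl
    have h1 := ha' (b i₀)
    rw [zero_smul, hψb, hPapply] at h1
    have h2 := Fintype.linearIndependent_iff.1 b.linearIndependent
      (fun j => (π (b.repr (φ (b i₀)) j) : K)) h1 j₀
    exact hπ (Subtype.ext h2)
  refine ⟨φ.trans (LinearEquiv.smulOfUnit (Units.mk0 a ha0)), fun γ v => ?_, fun i => ?_⟩
  · change a • φ (ρ γ v) = ρ _ (a • φ v)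
    rw [hφ, map_smul]
  · change a • φ (b i) ∈ _
    rw [← ha', hψb]
    exact hPmem _

/-- If an irreducible `ρ` of dimension `n` is defined over a subfield `F` whose `n`-torsion units
are `m`-th roots of unity, then the class of `ρ` comes from `μ_m`. -/
theorem autClass_mem_range_of_basis_mem_span {K Γ : Type} {V ι : Type*} [Field K] [IsAlgClosed K]
    [Group Γ] [AddCommGroup V] [Module K V] [FiniteDimensional K V] (ρ : Representation K Γ V)
    [ρ.IsIrreducible] [Fintype ι] (F : Subfield K) (b : Module.Basis ι K V)
    (hb : ∀ γ i, ρ γ (b i) ∈ Submodule.span F (Set.range b)) (m : ℕ)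
    (hF : ∀ x ∈ F, x ^ Fintype.card ι = 1 → x ^ m = 1) :
    ρ.autClass ∈ LinearMap.range
      (CentralExtension.cohomologyMap ρ.autStabilizer (rootsOfUnity m K).subtype 2) := by
  obtain ⟨hV, -⟩ := (isIrreducible_iff_forall_submodule ρ).1 ‹_›
  obtain ⟨i₀⟩ := b.index_nonempty
  choose φ hφ hφb using exists_intertwiner_mem_span ρ F b hb
  let s : ρ.autExtension.Section := ⟨fun σ => ⟨(σ, φ σ), hφ σ⟩, fun σ => rfl⟩
  let A : Subgroup Kˣ :=
    { carrier := {u | (u : K) ∈ F}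
      one_mem' := F.one_mem
      mul_mem' := fun hx hy => F.mul_mem hx hy
      inv_mem' := fun {x} hx => by
        change ((x⁻¹ : Kˣ) : K) ∈ F
        rw [Units.val_inv_eq_inv_val]
        exact F.inv_mem hx }
  have hs : ∀ g h, LinearEquiv.smulOfUnit (CentralExtension.factorSet ρ.autExtension s (g, h)) *
      φ (g * h) = φ g * φ h := fun g h =>
    congrArg (fun x : ρ.autLift => x.1.2) (CentralExtension.inl_factorSet_mul _ s g h)
  refine CentralExtension.extensionClass_mem_range_of_pow_eq_coboundary ρ.autExtension_isCentral
    ?_ A (rootsOfUnity m K) (Fintype.card ι) ?_ s ?_ (fun σ => LinearEquiv.det (φ σ)) ?_ ?_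
  · intro n hn x
    obtain ⟨y, hy⟩ := IsAlgClosed.exists_pow_nat_eq (x : K) (Nat.pos_of_ne_zero hn)
    have hy0 : y ≠ 0 := by
      rintro rfl
      exact x.ne_zero (by rw [← hy, zero_pow hn])
    exact ⟨Units.mk0 y hy0, Units.ext (by simpa using hy)⟩
  · intro x hx hxn
    rw [mem_rootsOfUnity']
    exact hF x hx (by rw [← Units.val_pow_eq_pow_val, hxn, Units.val_one])
  · rintro ⟨g, h⟩
    have h1 : ((CentralExtension.factorSet ρ.autExtension s (g, h) : Kˣ) : K) • φ (g * h) (b i₀)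
        = φ g (φ h (b i₀)) := LinearEquiv.congr_fun (hs g h) (b i₀)
    refine b.mem_of_smul_mem_span F (w := φ (g * h) (b i₀)) ?_ (hφb _ _) ?_
    · exact fun h0 => b.ne_zero i₀ ((φ (g * h)).map_eq_zero_iff.1 h0)
    · rw [h1]
      exact LinearMap.mem_span_of_forall_basis_mem_span F b (φ g).toLinearMap (hφb g) (hφb h i₀)
  · intro g
    change ((LinearEquiv.det (φ g) : Kˣ) : K) ∈ F
    rw [LinearEquiv.coe_det]
    exact b.det_mem_of_mem_span F _ (hφb g)
  · intro g h
    -- The determinant of a scalar is its power by the dimension, which is how `f ^ n` becomes a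
    -- coboundary.
    have h1 := congrArg LinearEquiv.det (hs g h)
    rw [map_mul, map_mul] at h1
    rw [← h1]
    congr 1
    apply Units.ext
    rw [LinearEquiv.coe_det, Units.val_pow_eq_pow_val]
    have h2 : ((LinearEquiv.smulOfUnit
        (CentralExtension.factorSet ρ.autExtension s (g, h)) : V ≃ₗ[K] V) : V →ₗ[K] V) = ((CentralExtension.factorSet ρ.autExtension s (g, h) : Kˣ) : K) •
          LinearMap.id := LinearMap.ext fun v => rfl
    rw [h2, LinearMap.det_smul, LinearMap.det_id, mul_one, Module.finrank_eq_card_basis b]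

end Representation

/-! ### Roots of unity in cyclotomic fields, and the theorem -/

/-- In `ℚ(ζ)` with `ζ` a primitive `p ^ r`-th root of unity and `r ≠ 0`, every root of unity of
`p`-power order is a `p ^ r`-th root of unity. -/
theorem IsPrimitiveRoot.pow_eq_one_of_mem_adjoin {K : Type*} [Field K] [CharZero K] {p r : ℕ}
    [hp : Fact p.Prime] (hr : r ≠ 0) {ζ : K} (hζ : IsPrimitiveRoot ζ (p ^ r)) {x : K}
    (hx : x ∈ IntermediateField.adjoin ℚ {ζ}) {k : ℕ} (hxk : x ^ p ^ k = 1) :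
    x ^ p ^ r = 1 := by
  by_contra hne
  have hfin : ∀ {n : ℕ} {y : K}, IsPrimitiveRoot y (p ^ n) →
      Module.finrank ℚ (IntermediateField.adjoin ℚ {y}) = (p ^ n).totient ∧ IsIntegral ℚ y := by
    intro n y hy
    have hpos : 0 < p ^ n := pow_pos hp.1.pos n
    have hint : IsIntegral ℚ y := (hy.isIntegral hpos).tower_top
    exact ⟨by rw [IntermediateField.adjoin.finrank hint,
      ← Polynomial.cyclotomic_eq_minpoly_rat hy hpos, Polynomial.natDegree_cyclotomic], hint⟩
  obtain ⟨s, hsk, hs⟩ := (Nat.dvd_prime_pow hp.1).1 (orderOf_dvd_of_pow_eq_one hxk)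
  have hrs : r < s := by
    by_contra! h
    exact hne (orderOf_dvd_iff_pow_eq_one.1 (hs ▸ pow_dvd_pow p h))
  have hxs : IsPrimitiveRoot x (p ^ s) := hs ▸ IsPrimitiveRoot.orderOf x
  -- A power of `x` has order exactly `p ^ (r + 1)`, so it has degree `p ^ r * (p - 1)` over `ℚ`,
  -- more than the degree `p ^ (r - 1) * (p - 1)` of `ζ`. For `r = 0` and `p = 2` the two degrees
  -- agree, and indeed `-1 ∈ ℚ`.
  have hy : IsPrimitiveRoot (x ^ p ^ (s - (r + 1))) (p ^ (r + 1)) :=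
    hxs.pow (pow_pos hp.1.pos s) (by rw [← pow_add]; congr 1; omega)
  have hle : IntermediateField.adjoin ℚ {x ^ p ^ (s - (r + 1))} ≤
      IntermediateField.adjoin ℚ {ζ} := by
    rw [IntermediateField.adjoin_simple_le_iff]
    exact pow_mem hx _
  have := IntermediateField.adjoin.finiteDimensional (hfin hζ).2
  have h1 := IntermediateField.finrank_le_of_le_right hle
  rw [(hfin hy).1, (hfin hζ).1, Nat.totient_prime_pow_succ hp.1,
    Nat.totient_prime_pow hp.1 (Nat.pos_of_ne_zero hr)] at h1
  have h2 : p ^ (r - 1) < p ^ r := Nat.pow_lt_pow_right hp.1.one_lt (by omega)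
  have h3 : 0 < p - 1 := Nat.sub_pos_of_lt hp.1.one_lt
  exact absurd h1 (not_le.2 (Nat.mul_lt_mul_of_pos_right h2 h3))

theorem corollaryc (p ℓ : ℕ) [Fact p.Prime] [Fact ℓ.Prime] (hpℓ : p ≠ ℓ)
    {Γ : Type} [Group Γ] [Finite Γ] (hΓ : IsPGroup p Γ)
    (r : ℕ) (hr : Monoid.exponent Γ = p ^ r)
    {V : Type*} [AddCommGroup V] [Module (PadicAlgCl ℓ) V] [FiniteDimensional (PadicAlgCl ℓ) V]
    (ρ : Representation (PadicAlgCl ℓ) Γ V) [ρ.IsIrreducible] :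
    ρ.autClass ∈ LinearMap.range
      (CentralExtension.cohomologyMap ρ.autStabilizer
        (rootsOfUnity (p ^ r) (PadicAlgCl ℓ)).subtype 2) := by
  have hp : p.Prime := Fact.out
  have : CharZero (PadicAlgCl ℓ) :=
    charZero_of_injective_algebraMap (algebraMap ℚ_[ℓ] (PadicAlgCl ℓ)).injective
  have : NeZero (p ^ r) := ⟨pow_ne_zero r hp.ne_zero⟩
  obtain ⟨ζ, hζ⟩ := HasEnoughRootsOfUnity.exists_primitiveRoot (PadicAlgCl ℓ) (p ^ r)
  let F : Subfield (PadicAlgCl ℓ) := (IntermediateField.adjoin ℚ {ζ}).toSubfield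
  obtain ⟨ι, _, b, hb, hbF⟩ := Representation.IsIrreducible.exists_basis_mem_span (p := p) F (p ^ r)
    (fun x hx => by
      obtain ⟨i, -, rfl⟩ := hζ.eq_pow_of_pow_eq_one hx
      exact F.pow_mem (IntermediateField.mem_adjoin_simple_self ℚ ζ) i)
    _ (Γ := Γ) rfl hΓ (fun γ => hr ▸ Monoid.pow_exponent_eq_one γ) ρ
  refine ρ.autClass_mem_range_of_basis_mem_span F b hbF (p ^ r) fun x hx hxn => ?_
  obtain ⟨k, hk⟩ := IsPGroup.iff_card.1 hΓ
  rw [hk] at hb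
  obtain ⟨m, -, hm⟩ := (Nat.dvd_prime_pow hp).1 hb
  rw [hm] at hxn
  -- For `r = 0` the group is trivial, so the dimension is `1` and there is no torsion to control.
  rcases eq_or_ne r 0 with rfl | hr0
  · have hΓ1 : Nat.card Γ = 1 := by
      rw [Nat.card_eq_one_iff_unique]
      exact ⟨Monoid.exp_eq_one_iff.1 (by simpa using hr), ⟨1⟩⟩
    rw [← hk, hΓ1, Nat.dvd_one, hm] at hb
    rwa [pow_zero, ← hb]
  · exact hζ.pow_eq_one_of_mem_adjoin hr0 hx hxn
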